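/- Let $\mathcal F_{op}$ be the class of functions $f:(0,\infty)\to(0,\infty)$ that are operator monotone (for every $m$ and all positive definite $A\le B$ in $M_m(\mathbb C)$ one has $0\le f(A)\le f(B)$), normalized ($f(1)=1$) and symmetric ($x f(x^{-1})=f(x)$ for all $x>0$). For $f\in\mathcal F_{op}$ put $f(0):=\lim_{x\to0^+}f(x)$ and $$\tilde f(x):=\tfrac12\Big[(x+1)-(x-1)^2\,\frac{f(0)}{f(x)}\Big]\qquad(x>0).$$ Let $\rho\in M_n(\mathbb C)$ be a faithful state, i.e. $\rho$ is positive definite with $\operatorname{Tr}\rho=1$, and let $A,B\in M_n(\mathbb C)$ be self-adjoint. Put $\operatorname{Cov}_\rho(A,B):=\operatorname{Tr}(\rho AB)-\operatorname{Tr}(\rho A)\operatorname{Tr}(\rho B)$, $\operatorname{Var}_\rho(A):=\operatorname{Cov}_\rho(A,A)$ and $\operatorname{Cov}^s_\rho(A,B):=\frac12[\operatorname{Cov}_\rho(A,B)+\operatorname{Cov}_\rho(B,A)]$. For $f\in\mathcal F_{op}$ let $c_f(x,y):=\frac1{y f(x/y)}$ for $x,y>0$, let $L_\rho(X)=\rho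 X$ and $R_\rho(X)=X\rho$, and define for self-adjoint $u,v$ $$\langle u,v\rangle_{\rho,f}:=\operatorname{Tr}\big(u\cdot c_f(L_\rho,R_\rho)(v)\big),\qquad \operatorname{Area}^f_\rho(u,v):=\sqrt{\langle u,u\rangle_{\rho,f}\langle v,v\rangle_{\rho,f}-|\langle u,v\rangle_{\rho,f}|^2},$$ where $c_f(L_\rho,R_\rho)$ is given by the functional calculus of the commuting self-adjoint operators $L_\rho,R_\rho$. With $[X,Y]=XY-YX$, for all $f,g\in\mathcal F_{op}$ the following hold. (i) $$\operatorname{Var}_\rho(A)\operatorname{Var}_\rho(B)-|\operatorname{Cov}^s_\rho(A,B)|^2\ \ge\ \Big(\frac{f(0)}2\operatorname{Area}^f_\rho(i[\rho,A],i[\rho,B])\Big)^2.$$ (ii) If $\tilde f(x)\le\tilde g(x)$ for all $x>0$, then $$\frac{g(0)}2\operatorname{Area}^g_\rho(i[\rho,A],i[\rho,B])\ \le\ \frac{f(0)}2\operatorname{Area}^f_\rho(i[\rho,A],i[\rho,B]).$$ -/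

import Mathlib

open Filter Topology
open scoped MatrixOrder ComplexOrder

noncomputable section

namespace MonotoneMetric

/-! ### Normalized symmetric operator monotone functions

A function on `(0, ∞)` is represented by a function `ℝ → ℝ` of which only the values at positive
arguments are ever used. -/

/-- `f : (0, ∞) → ℝ` is operator monotone: for all `n` and all positive definite `n × n` complex
matrices `A ≤ B` (Loewner order) one has `0 ≤ f(A) ≤ f(B)`. Here `f(A) = cfc f A` is the functional
calculus of the self-adjoint matrix `A`; it only involves the values of `f` at the eigenvalues of
`A`, which are positive. -/
def IsOperatorMonotone (f : ℝ → ℝ) : Prop :=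
  ∀ (n : ℕ) (A B : Matrix (Fin n) (Fin n) ℂ), A.PosDef → A ≤ B →
    0 ≤ cfc f A ∧ cfc f A ≤ cfc f B

/-- The class of normalized symmetric operator monotone functions `(0, ∞) → (0, ∞)`. -/
structure Fop (f : ℝ → ℝ) : Prop where
  pos : ∀ x, 0 < x → 0 < f x
  normalized : f 1 = 1
  symmetric : ∀ x, 0 < x → x * f x⁻¹ = f x
  operatorMonotone : IsOperatorMonotone f

/-- `f(0) = lim_{x → 0+} f(x)`. -/
def valZero (f : ℝ → ℝ) : ℝ := limUnder (𝓝[>] (0 : ℝ)) f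

/-- An operator monotone function is increasing on `(0, ∞)`. -/
theorem IsOperatorMonotone.monotoneOn {f : ℝ → ℝ} (hf : IsOperatorMonotone f) :
    MonotoneOn f (Set.Ioi 0) := by
  intro x hx y _ hxy
  have key := (hf 1 (algebraMap ℝ _ x) (algebraMap ℝ _ y) ?_ ?_).2
  · rw [cfc_algebraMap, cfc_algebraMap, Matrix.le_iff] at key
    have := key.diag_nonneg (i := 0)
    simpa [Matrix.algebraMap_matrix_apply, ← Complex.ofReal_sub] using this
  · rw [Algebra.algebraMap_eq_smul_one]
    exact Matrix.PosDef.one.smul hx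
  · rw [Matrix.le_iff, ← map_sub, Algebra.algebraMap_eq_smul_one]
    exact Matrix.PosSemidef.one.smul (sub_nonneg.2 hxy)

/-- The limit that defines `f(0)` exists for every `f` in the class. -/
theorem Fop.tendsto_valZero {f : ℝ → ℝ} (hf : Fop f) :
    Tendsto f (𝓝[>] (0 : ℝ)) (𝓝 (valZero f)) := by
  apply tendsto_nhds_limUnder
  refine ⟨_, hf.operatorMonotone.monotoneOn.tendsto_nhdsGT ?_⟩
  refine ⟨0, ?_⟩
  rintro _ ⟨x, hx, rfl⟩
  exact (hf.pos x hx).le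

/-- `f̃(x) = ((x + 1) - (x - 1)² f(0) / f(x)) / 2`. -/
def tilde (f : ℝ → ℝ) (x : ℝ) : ℝ :=
  (1 / 2) * ((x + 1) - (x - 1) ^ 2 * (valZero f / f x))

/-- The mean `m_f(x, y) = y f(x / y)` of positive numbers. -/
def mean (f : ℝ → ℝ) (x y : ℝ) : ℝ := y * f (x * y⁻¹)

/-- The Chentsov-Morozova function `c_f(x, y) = 1 / (y f(x / y)) = m_f(x, y)⁻¹`. -/
def cmFun (f : ℝ → ℝ) (x y : ℝ) : ℝ := (mean f x y)⁻¹

/-! ### Functions of left and right multiplication -/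

variable {n : ℕ} {ρ : Matrix (Fin n) (Fin n) ℂ}

/-- The orthogonal projector on the line spanned by the `i`-th vector of an orthonormal basis of
eigenvectors of the Hermitian matrix `ρ`; the corresponding eigenvalue is `hρ.eigenvalues i`. -/
def eigenProj (hρ : ρ.IsHermitian) (i : Fin n) : Matrix (Fin n) (Fin n) ℂ :=
  Matrix.vecMulVec (hρ.eigenvectorBasis i).ofLp (star (hρ.eigenvectorBasis i).ofLp)

/-- The joint functional calculus of the commuting self-adjoint superoperators
`L_ρ : X ↦ ρ X` and `R_ρ : X ↦ X ρ`:
`s(L_ρ, R_ρ) = ∑_{i,j} s(λ_i, λ_j) L_{E_i} R_{E_j}`, with `λ_i` the eigenvalues of `ρ` (repeated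
according to multiplicity) and `E_i` the associated eigenprojectors. -/
def superFun (s : ℝ → ℝ → ℝ) (hρ : ρ.IsHermitian) :
    Module.End ℂ (Matrix (Fin n) (Fin n) ℂ) :=
  ∑ i, ∑ j, ((s (hρ.eigenvalues i) (hρ.eigenvalues j) : ℝ) : ℂ) •
    (LinearMap.mulLeft ℂ (eigenProj hρ i) ∘ₗ LinearMap.mulRight ℂ (eigenProj hρ j))

theorem superFun_apply (s : ℝ → ℝ → ℝ) (hρ : ρ.IsHermitian) (X : Matrix (Fin n) (Fin n) ℂ) :
    superFun s hρ X = ∑ i, ∑ j, ((s (hρ.eigenvalues i) (hρ.eigenvalues j) : ℝ) : ℂ) •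
      (eigenProj hρ i * X * eigenProj hρ j) := by
  simp [superFun, Matrix.mul_assoc]

theorem eigenProj_conjTranspose (hρ : ρ.IsHermitian) (i : Fin n) :
    (eigenProj hρ i).conjTranspose = eigenProj hρ i := by
  simp [eigenProj, Matrix.conjTranspose_vecMulVec]

theorem mul_eigenProj (hρ : ρ.IsHermitian) (i : Fin n) :
    ρ * eigenProj hρ i = ((hρ.eigenvalues i : ℝ) : ℂ) • eigenProj hρ i := by
  rw [eigenProj, Matrix.mul_vecMulVec, hρ.mulVec_eigenvectorBasis, Matrix.smul_vecMulVec]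
  rfl

theorem eigenProj_mul (hρ : ρ.IsHermitian) (i : Fin n) :
    eigenProj hρ i * ρ = ((hρ.eigenvalues i : ℝ) : ℂ) • eigenProj hρ i := by
  have h := congrArg Matrix.conjTranspose (mul_eigenProj hρ i)
  simpa [Matrix.conjTranspose_mul, eigenProj_conjTranspose, hρ.eq] using h

theorem sum_eigenProj (hρ : ρ.IsHermitian) : ∑ i, eigenProj hρ i = 1 := by
  have h : (hρ.eigenvectorUnitary : Matrix (Fin n) (Fin n) ℂ) *
      (star hρ.eigenvectorUnitary : Matrix (Fin n) (Fin n) ℂ) = 1 :=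
    Unitary.coe_mul_star_self _
  rw [← h]
  ext a b
  simp [eigenProj, Matrix.sum_apply, Matrix.vecMulVec_apply, Matrix.mul_apply,
    Matrix.star_apply, Matrix.IsHermitian.eigenvectorUnitary_apply]

/-- `s(L_ρ, R_ρ)` acts on every joint eigenvector of `L_ρ` and `R_ρ`, with eigenvalues `a` and `b`,
as multiplication by `s(a, b)`. -/
theorem superFun_apply_eigenvector (s : ℝ → ℝ → ℝ) (hρ : ρ.IsHermitian)
    {X : Matrix (Fin n) (Fin n) ℂ} {a b : ℝ} (ha : LinearMap.mulLeft ℂ ρ X = (a : ℂ) • X)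
    (hb : LinearMap.mulRight ℂ ρ X = (b : ℂ) • X) :
    superFun s hρ X = ((s a b : ℝ) : ℂ) • X := by
  simp only [LinearMap.mulLeft_apply, LinearMap.mulRight_apply] at ha hb
  have hterm : ∀ i j, ((s (hρ.eigenvalues i) (hρ.eigenvalues j) : ℝ) : ℂ) •
      (eigenProj hρ i * X * eigenProj hρ j) =
      ((s a b : ℝ) : ℂ) • (eigenProj hρ i * X * eigenProj hρ j) := by
    intro i j
    by_cases h0 : eigenProj hρ i * X * eigenProj hρ j = 0
    · simp [h0]
    have h1 : ((hρ.eigenvalues i : ℝ) : ℂ) • (eigenProj hρ i * X * eigenProj hρ j) =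
        (a : ℂ) • (eigenProj hρ i * X * eigenProj hρ j) := by
      rw [← Matrix.smul_mul, ← Matrix.smul_mul, ← eigenProj_mul, Matrix.mul_assoc _ ρ X, ha]
      simp
    have h2 : ((hρ.eigenvalues j : ℝ) : ℂ) • (eigenProj hρ i * X * eigenProj hρ j) =
        (b : ℂ) • (eigenProj hρ i * X * eigenProj hρ j) := by
      rw [← Matrix.mul_smul, ← mul_eigenProj, ← Matrix.mul_assoc, Matrix.mul_assoc _ X ρ, hb]
      simp
    have e1 : hρ.eigenvalues i = a := by exact_mod_cast smul_left_injective ℂ h0 h1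
    have e2 : hρ.eigenvalues j = b := by exact_mod_cast smul_left_injective ℂ h0 h2
    rw [e1, e2]
  rw [superFun_apply, Finset.sum_congr rfl fun i _ => Finset.sum_congr rfl fun j _ => hterm i j]
  simp_rw [← Finset.smul_sum, ← Finset.mul_sum, ← Finset.sum_mul]
  simp [sum_eigenProj]

/-! ### The monotone metric and its area functional -/

/-- The monotone metric `⟨A, B⟩_{ρ,f} = Tr(A c_f(L_ρ, R_ρ)(B))` on self-adjoint matrices, where
this trace is a real number. -/
def metric (f : ℝ → ℝ) (hρ : ρ.IsHermitian) (A B : Matrix (Fin n) (Fin n) ℂ) : ℝ :=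
  (Matrix.trace (A * superFun (cmFun f) hρ B)).re

/-- For self-adjoint `A` and `B` the trace `Tr(A c_f(L_ρ, R_ρ)(B))` is real. -/
theorem trace_superFun_im {f : ℝ → ℝ} (hf : Fop f) (hρ : ρ.PosDef)
    {A B : Matrix (Fin n) (Fin n) ℂ} (hA : A.IsHermitian) (hB : B.IsHermitian) :
    (Matrix.trace (A * superFun (cmFun f) hρ.isHermitian B)).im = 0 := by
  have hsymm : ∀ x y, 0 < x → 0 < y → cmFun f x y = cmFun f y x := by
    intro x y hx hy
    have h := hf.symmetric (x * y⁻¹) (by positivity)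
    simp only [cmFun, mean]
    rw [← h, show (x * y⁻¹)⁻¹ = y * x⁻¹ by rw [mul_inv, inv_inv, mul_comm]]
    field_simp
  have hH : (superFun (cmFun f) hρ.isHermitian B).IsHermitian := by
    rw [Matrix.IsHermitian, superFun_apply]
    simp only [Matrix.conjTranspose_sum, Matrix.conjTranspose_smul, Matrix.conjTranspose_mul,
      eigenProj_conjTranspose, hB.eq, Complex.star_def, Complex.conj_ofReal, Matrix.mul_assoc]
    rw [Finset.sum_comm]
    refine Finset.sum_congr rfl fun i _ => Finset.sum_congr rfl fun j _ => ?_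
    rw [hsymm _ _ (hρ.eigenvalues_pos j) (hρ.eigenvalues_pos i)]
  rw [← Complex.conj_eq_iff_im, ← Complex.star_def, ← Matrix.trace_conjTranspose,
    Matrix.conjTranspose_mul, hA.eq, hH.eq, Matrix.trace_mul_comm]

/-- `√(g(v,v) g(w,w) - |g(v,w)|²)`, the area of the parallelogram spanned by `v` and `w` with
respect to the scalar product `g`. -/
def area {V : Type*} (g : V → V → ℝ) (v w : V) : ℝ :=
  √(g v v * g w w - |g v w| ^ 2)

/-! ### Covariance and variance -/

/-- `Cov_ρ(A, B) = Tr(ρAB) - Tr(ρA) Tr(ρB)`. -/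
def cov (ρ A B : Matrix (Fin n) (Fin n) ℂ) : ℂ :=
  Matrix.trace (ρ * A * B) - Matrix.trace (ρ * A) * Matrix.trace (ρ * B)

/-- `Cov^s_ρ(A, B) = (Cov_ρ(A, B) + Cov_ρ(B, A)) / 2`. -/
def symCov (ρ A B : Matrix (Fin n) (Fin n) ℂ) : ℂ :=
  (1 / 2) * (cov ρ A B + cov ρ B A)

/-- `Var_ρ(A) = Cov_ρ(A, A)`, which is a real number for self-adjoint `ρ` and `A`. -/
def var (ρ A : Matrix (Fin n) (Fin n) ℂ) : ℝ := (cov ρ A A).re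

/-- `i[ρ, A] = i(ρA - Aρ)`. -/
def iComm (ρ A : Matrix (Fin n) (Fin n) ℂ) : Matrix (Fin n) (Fin n) ℂ :=
  Complex.I • (ρ * A - A * ρ)

end MonotoneMetric

end

noncomputable section

namespace MonotoneMetric

open scoped ComplexConjugate

/-! ### Scalar inequalities -/

/-! In an eigenbasis of `ρ` every form involved is diagonal in the matrix entries, with weights
depending on the eigenvalue pair `(x, y)`. Passing to `i[ρ, A]` multiplies an entry by `i(x - y)`,
so `f(0)/2` times the metric has weight `f(0)(x - y)² c_f / 2 = (x + y)/2 - m_f̃`, while the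
symmetrized covariance of centered observables has weight `(x + y)/2`. Centering does not change
commutators, so both sides of (i) are Gram determinants of the same two vectors, as are the squares
of both sides of (ii). A Gram determinant increases with the weights (`gram_wInner_mono`). Hence (i)
reduces to `f̃ ≥ 0` (`Fop.tilde_nonneg`), and (ii) to `f̃ ≤ g̃`. Operator monotonicity enters only
through monotonicity on `(0, ∞)`. -/

theorem Fop.valZero_le {f : ℝ → ℝ} (hf : Fop f) {x : ℝ} (hx : 0 < x) : valZero f ≤ f x := by
  refine le_of_tendsto hf.tendsto_valZero ?_
  filter_upwards [Ioc_mem_nhdsGT hx] with y hy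
  exact hf.operatorMonotone.monotoneOn hy.1 hx hy.2

theorem Fop.valZero_nonneg {f : ℝ → ℝ} (hf : Fop f) : 0 ≤ valZero f := by
  refine ge_of_tendsto hf.tendsto_valZero ?_
  filter_upwards [self_mem_nhdsWithin] with y hy
  exact (hf.pos y hy).le

theorem Fop.mul_valZero_le {f : ℝ → ℝ} (hf : Fop f) {x : ℝ} (hx : 0 < x) :
    x * valZero f ≤ f x := by
  rw [← hf.symmetric x hx]
  exact mul_le_mul_of_nonneg_left (hf.valZero_le (inv_pos.2 hx)) hx.le

/-- Adding `f(0) ≤ f(x)` and `x` times `x f(0) ≤ f(x)` gives `(x² + 1) f(0) ≤ (x + 1) f(x)`, and `(x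
- 1)² ≤ x² + 1`. -/
theorem Fop.tilde_nonneg {f : ℝ → ℝ} (hf : Fop f) {x : ℝ} (hx : 0 < x) : 0 ≤ tilde f x := by
  have h0 := hf.valZero_nonneg
  have h1 := hf.valZero_le hx
  have h2 := hf.mul_valZero_le hx
  have key : (x - 1) ^ 2 * (valZero f / f x) ≤ x + 1 := by
    rw [← mul_div_assoc, div_le_iff₀ (hf.pos x hx)]
    nlinarith [mul_le_mul_of_nonneg_left h2 hx.le, mul_nonneg hx.le h0]
  unfold tilde
  linarith

/-- The weight `f(0) (x - y)² c_f(x, y) / 2`, which equals `(x + y) / 2 - m_f̃(x, y)`. -/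
def commWeight (f : ℝ → ℝ) (x y : ℝ) : ℝ := valZero f / 2 * ((x - y) ^ 2 * cmFun f x y)

theorem commWeight_eq_sub_mean_tilde (f : ℝ → ℝ) (x : ℝ) {y : ℝ} (hy : 0 < y) :
    commWeight f x y = (x + y) / 2 - mean (tilde f) x y := by
  simp only [commWeight, cmFun, mean, tilde]
  rw [div_eq_mul_inv (valZero f) (f _), mul_inv]
  -- The identity is affine in `1 / f(x/y)`, so it needs no property of `f`.
  generalize (f (x * y⁻¹))⁻¹ = c
  field_simp
  ring

theorem Fop.commWeight_nonneg {f : ℝ → ℝ} (hf : Fop f) {x y : ℝ} (hx : 0 < x) (hy : 0 < y) :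
    0 ≤ commWeight f x y := by
  have h0 := hf.valZero_nonneg
  have h1 := hf.pos (x * y⁻¹) (by positivity)
  unfold commWeight cmFun mean
  positivity

theorem Fop.commWeight_le {f : ℝ → ℝ} (hf : Fop f) {x y : ℝ} (hx : 0 < x) (hy : 0 < y) :
    commWeight f x y ≤ (x + y) / 2 := by
  rw [commWeight_eq_sub_mean_tilde f x hy]
  exact sub_le_self _ (mul_nonneg hy.le (hf.tilde_nonneg (by positivity)))

theorem commWeight_le_of_tilde_le {f g : ℝ → ℝ} (h : ∀ x, 0 < x → tilde f x ≤ tilde g x)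
    {x y : ℝ} (hx : 0 < x) (hy : 0 < y) : commWeight g x y ≤ commWeight f x y := by
  rw [commWeight_eq_sub_mean_tilde f x hy, commWeight_eq_sub_mean_tilde g x hy]
  exact sub_le_sub_left (mul_le_mul_of_nonneg_left (h _ (by positivity)) hy.le) _

/-! ### Gram determinants of weighted inner products -/

/-- The real inner product on `ι → ℂ` with weights `w`. -/
def wInner {ι : Type*} [Fintype ι] (w : ι → ℝ) (a b : ι → ℂ) : ℝ :=
  ∑ i, w i * (conj (a i) * b i).re

section Gram

variable {ι : Type*} [Fintype ι]

theorem wInner_self_nonneg {w : ι → ℝ} (hw : ∀ i, 0 ≤ w i) (a : ι → ℂ) : 0 ≤ wInner w a a := by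
  refine Finset.sum_nonneg fun i _ => mul_nonneg (hw i) ?_
  simp only [Complex.mul_re, Complex.conj_re, Complex.conj_im]
  nlinarith [mul_self_nonneg (a i).re, mul_self_nonneg (a i).im]

theorem wInner_sq_le {w : ι → ℝ} (hw : ∀ i, 0 ≤ w i) (a b : ι → ℂ) :
    wInner w a b ^ 2 ≤ wInner w a a * wInner w b b := by
  refine Finset.sum_sq_le_sum_mul_sum_of_sq_le_mul _ (fun i _ => ?_) (fun i _ => ?_)
    fun i _ => ?_
  · refine mul_nonneg (hw i) ?_
    simp only [Complex.mul_re, Complex.conj_re, Complex.conj_im]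
    nlinarith [mul_self_nonneg (a i).re, mul_self_nonneg (a i).im]
  · refine mul_nonneg (hw i) ?_
    simp only [Complex.mul_re, Complex.conj_re, Complex.conj_im]
    nlinarith [mul_self_nonneg (b i).re, mul_self_nonneg (b i).im]
  · simp only [Complex.mul_re, Complex.conj_re, Complex.conj_im]
    -- The two sides differ by the square of `w i * Im(conj (a i) * b i)`.
    nlinarith [sq_nonneg (w i * ((a i).re * (b i).im - (a i).im * (b i).re))]

theorem wInner_sub (w w' : ι → ℝ) (a b : ι → ℂ) :
    wInner (fun i => w' i - w i) a b = wInner w' a b - wInner w a b := by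
  simp [wInner, sub_mul]

/-- The Gram determinant of two vectors is monotone in the weights. -/
theorem gram_wInner_mono {w w' : ι → ℝ} (hw : ∀ i, 0 ≤ w i) (hww' : ∀ i, w i ≤ w' i)
    (a b : ι → ℂ) :
    wInner w a a * wInner w b b - wInner w a b ^ 2 ≤
      wInner w' a a * wInner w' b b - wInner w' a b ^ 2 := by
  have hd : ∀ i, 0 ≤ w' i - w i := fun i => sub_nonneg.2 (hww' i)
  have h1 := wInner_sq_le hw a b
  have h2 := wInner_sq_le hd a b
  have ha := wInner_self_nonneg hw a
  have hb := wInner_self_nonneg hw b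
  have ha' := wInner_self_nonneg hd a
  have hb' := wInner_self_nonneg hd b
  have ea := wInner_sub w w' a a
  have eb := wInner_sub w w' b b
  have eab := wInner_sub w w' a b
  rw [show wInner w' a a = wInner w a a + wInner (fun i => w' i - w i) a a by linarith,
    show wInner w' b b = wInner w b b + wInner (fun i => w' i - w i) b b by linarith,
    show wInner w' a b = wInner w a b + wInner (fun i => w' i - w i) a b by linarith]
  clear ea eb eab
  generalize wInner w a a = p, wInner w b b = q, wInner w a b = r,
    wInner (fun i => w' i - w i) a a = p', wInner (fun i => w' i - w i) b b = q',
    wInner (fun i => w' i - w i) a b = r' at *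
  -- The determinant of the sum is the sum of the two determinants plus `p q' + p' q - 2 r r'`.
  -- Cauchy-Schwarz gives `(r r')² ≤ (p q')(p' q)`, and AM-GM bounds this by `((p q' + p' q)/2)²`.
  have hcross : 2 * (r * r') ≤ p * q' + p' * q := by
    refine le_of_sq_le_sq ?_ (by positivity)
    have := mul_le_mul h1 h2 (sq_nonneg r') (mul_nonneg ha hb)
    nlinarith [sq_nonneg (p * q' - p' * q)]
  nlinarith

end Gram

/-! ### Matrix entries in an eigenbasis -/

variable {n : ℕ} {ρ : Matrix (Fin n) (Fin n) ℂ}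

/-- The entries of `A` in the eigenbasis of `ρ`. -/
def eigenEntry (hρ : ρ.IsHermitian) (A : Matrix (Fin n) (Fin n) ℂ) (p : Fin n × Fin n) : ℂ :=
  star (hρ.eigenvectorBasis p.1).ofLp ⬝ᵥ (A.mulVec (hρ.eigenvectorBasis p.2).ofLp)

/-- The values of `s` at the pairs of eigenvalues of `ρ`. -/
def eigenWeight (s : ℝ → ℝ → ℝ) (hρ : ρ.IsHermitian) (p : Fin n × Fin n) : ℝ :=
  s (hρ.eigenvalues p.1) (hρ.eigenvalues p.2)

/-- Both projectors have rank one, so the trace splits into two scalar factors. -/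
theorem trace_mul_eigenProj (hρ : ρ.IsHermitian) (A B : Matrix (Fin n) (Fin n) ℂ) (i j : Fin n) :
    (A * (eigenProj hρ i * B * eigenProj hρ j)).trace =
      eigenEntry hρ A (j, i) * eigenEntry hρ B (i, j) := by
  rw [eigenProj, eigenProj, Matrix.vecMulVec_mul, Matrix.vecMulVec_mul_vecMulVec,
    Matrix.mul_vecMulVec, Matrix.trace_vecMulVec, dotProduct_smul, smul_eq_mul,
    ← Matrix.dotProduct_mulVec, dotProduct_comm (A.mulVec _), mul_comm, eigenEntry, eigenEntry]

theorem eigenEntry_swap (hρ : ρ.IsHermitian) {A : Matrix (Fin n) (Fin n) ℂ} (hA : A.IsHermitian)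
    (i j : Fin n) : eigenEntry hρ A (j, i) = conj (eigenEntry hρ A (i, j)) := by
  simp only [eigenEntry]
  rw [← Complex.star_def, ← Matrix.star_dotProduct_star, star_star, Matrix.star_mulVec, hA.eq,
    Matrix.dotProduct_mulVec, dotProduct_comm]

theorem re_trace_mul_superFun (s : ℝ → ℝ → ℝ) (hρ : ρ.IsHermitian)
    {A : Matrix (Fin n) (Fin n) ℂ} (hA : A.IsHermitian) (B : Matrix (Fin n) (Fin n) ℂ) :
    (A * superFun s hρ B).trace.re =
      wInner (eigenWeight s hρ) (eigenEntry hρ A) (eigenEntry hρ B) := by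
  simp only [superFun_apply, Finset.mul_sum, Matrix.trace_sum, Matrix.mul_smul, Matrix.trace_smul,
    trace_mul_eigenProj, wInner, Fintype.sum_prod_type, eigenWeight, Complex.re_sum, smul_eq_mul,
    Complex.re_ofReal_mul]
  refine Finset.sum_congr rfl fun i _ => Finset.sum_congr rfl fun j _ => ?_
  rw [eigenEntry_swap hρ hA]

theorem eigenEntry_iComm (hρ : ρ.IsHermitian) (A : Matrix (Fin n) (Fin n) ℂ)
    (p : Fin n × Fin n) :
    eigenEntry hρ (iComm ρ A) p =
      Complex.I * ((hρ.eigenvalues p.1 - hρ.eigenvalues p.2 : ℝ) : ℂ) * eigenEntry hρ A p := by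
  have h1 : star (hρ.eigenvectorBasis p.1).ofLp ⬝ᵥ
      ((ρ * A).mulVec (hρ.eigenvectorBasis p.2).ofLp) =
      hρ.eigenvalues p.1 * eigenEntry hρ A p := by
    have h := congrArg star (hρ.mulVec_eigenvectorBasis p.1)
    rw [Matrix.star_mulVec, hρ.eq] at h
    rw [Matrix.dotProduct_mulVec, ← Matrix.vecMul_vecMul, h, eigenEntry]
    simp [Matrix.dotProduct_mulVec, Matrix.smul_vecMul]
  have h2 : star (hρ.eigenvectorBasis p.1).ofLp ⬝ᵥ
      ((A * ρ).mulVec (hρ.eigenvectorBasis p.2).ofLp) =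
      hρ.eigenvalues p.2 * eigenEntry hρ A p := by
    rw [← Matrix.mulVec_mulVec, hρ.mulVec_eigenvectorBasis, eigenEntry]
    simp [Matrix.mulVec_smul]
  rw [eigenEntry, iComm, Matrix.smul_mulVec, Matrix.sub_mulVec, dotProduct_smul, dotProduct_sub,
    h1, h2, smul_eq_mul]
  push_cast
  ring

theorem iComm_isHermitian (hρ : ρ.IsHermitian) {A : Matrix (Fin n) (Fin n) ℂ}
    (hA : A.IsHermitian) : (iComm ρ A).IsHermitian := by
  rw [Matrix.IsHermitian, iComm, Matrix.conjTranspose_smul, Matrix.conjTranspose_sub,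
    Matrix.conjTranspose_mul, Matrix.conjTranspose_mul, hρ.eq, hA.eq, Complex.star_def,
    Complex.conj_I, neg_smul, ← smul_neg, neg_sub]

theorem valZero_mul_metric_iComm (f : ℝ → ℝ) (hρ : ρ.IsHermitian)
    {A : Matrix (Fin n) (Fin n) ℂ} (hA : A.IsHermitian) (B : Matrix (Fin n) (Fin n) ℂ) :
    valZero f / 2 * metric f hρ (iComm ρ A) (iComm ρ B) =
      wInner (eigenWeight (commWeight f) hρ) (eigenEntry hρ A) (eigenEntry hρ B) := by
  rw [metric, re_trace_mul_superFun _ hρ (iComm_isHermitian hρ hA), wInner, wInner,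
    Finset.mul_sum]
  refine Finset.sum_congr rfl fun p _ => ?_
  simp only [eigenEntry_iComm, eigenWeight, commWeight, map_mul, Complex.conj_I,
    Complex.conj_ofReal]
  simp only [Complex.mul_re, Complex.mul_im, Complex.conj_re, Complex.conj_im, Complex.neg_re,
    Complex.neg_im, Complex.I_re, Complex.I_im, Complex.ofReal_re, Complex.ofReal_im]
  ring

/-- The area is homogeneous of degree one in the form, for nonnegative factors such as `f(0)/2`. -/
theorem valZero_mul_area_iComm {f : ℝ → ℝ} (hf : Fop f) (hρ : ρ.IsHermitian)
    {A B : Matrix (Fin n) (Fin n) ℂ} (hA : A.IsHermitian) (hB : B.IsHermitian) :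
    valZero f / 2 * area (metric f hρ) (iComm ρ A) (iComm ρ B) =
      area (wInner (eigenWeight (commWeight f) hρ)) (eigenEntry hρ A) (eigenEntry hρ B) := by
  have h0 : 0 ≤ valZero f / 2 := by linarith [hf.valZero_nonneg]
  rw [area, area, ← Real.sqrt_sq h0, ← Real.sqrt_mul (sq_nonneg _),
    ← valZero_mul_metric_iComm f hρ hA, ← valZero_mul_metric_iComm f hρ hB,
    ← valZero_mul_metric_iComm f hρ hA, sq_abs, sq_abs]
  ring_nf

/-! ### Covariance in an eigenbasis -/

/-- Places the symmetrized covariance in the same family of forms as the metrics, with the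
arithmetic mean as weight. -/
theorem superFun_arith (hρ : ρ.IsHermitian) (X : Matrix (Fin n) (Fin n) ℂ) :
    superFun (fun x y => (x + y) / 2) hρ X = (1 / 2 : ℂ) • (ρ * X + X * ρ) := by
  have h1 : ∑ i, ((hρ.eigenvalues i : ℝ) : ℂ) • eigenProj hρ i = ρ := by
    simp_rw [← mul_eigenProj, ← Finset.mul_sum, sum_eigenProj, mul_one]
  have h2 : ∑ i, ∑ j, ((hρ.eigenvalues i : ℝ) : ℂ) • (eigenProj hρ i * X * eigenProj hρ j) =
      ρ * X := by
    simp_rw [← Finset.smul_sum, ← Finset.mul_sum, sum_eigenProj, mul_one, ← Matrix.smul_mul,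
      ← Finset.sum_mul, h1]
  have h3 : ∑ i, ∑ j, ((hρ.eigenvalues j : ℝ) : ℂ) • (eigenProj hρ i * X * eigenProj hρ j) =
      X * ρ := by
    simp_rw [← Matrix.mul_smul, ← Finset.mul_sum, h1, ← Finset.sum_mul, sum_eigenProj, one_mul]
  rw [superFun_apply, ← h2, ← h3, ← Finset.sum_add_distrib, Finset.smul_sum]
  refine Finset.sum_congr rfl fun i _ => ?_
  rw [← Finset.sum_add_distrib, Finset.smul_sum]
  refine Finset.sum_congr rfl fun j _ => ?_
  rw [← add_smul, smul_smul]
  push_cast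
  ring_nf

/-- `A - Tr(ρA)`. -/
def centered (ρ A : Matrix (Fin n) (Fin n) ℂ) : Matrix (Fin n) (Fin n) ℂ :=
  A - (ρ * A).trace • 1

theorem trace_mul_conj {A : Matrix (Fin n) (Fin n) ℂ} (hρ : ρ.IsHermitian)
    (hA : A.IsHermitian) : star (ρ * A).trace = (ρ * A).trace := by
  rw [← Matrix.trace_conjTranspose, Matrix.conjTranspose_mul, hρ.eq, hA.eq, Matrix.trace_mul_comm]

theorem centered_isHermitian {A : Matrix (Fin n) (Fin n) ℂ} (hρ : ρ.IsHermitian)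
    (hA : A.IsHermitian) : (centered ρ A).IsHermitian := by
  rw [Matrix.IsHermitian, centered, Matrix.conjTranspose_sub, Matrix.conjTranspose_smul, hA.eq,
    trace_mul_conj hρ hA, Matrix.conjTranspose_one]

theorem iComm_centered (ρ A : Matrix (Fin n) (Fin n) ℂ) : iComm ρ (centered ρ A) = iComm ρ A := by
  simp [iComm, centered, mul_sub, sub_mul]

theorem cov_eq_trace_centered (htr : ρ.trace = 1) (A B : Matrix (Fin n) (Fin n) ℂ) :
    cov ρ A B = (ρ * centered ρ A * centered ρ B).trace := by
  simp only [cov, centered, mul_sub, sub_mul, Matrix.trace_sub, Matrix.mul_smul, Matrix.smul_mul,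
    mul_one, Matrix.trace_smul, smul_eq_mul, htr]
  ring

/-- By cyclicity, `Tr(ρXY) + Tr(ρYX) = Tr(X(ρY + Yρ))`, applied to the centered observables. -/
theorem symCov_eq_trace_superFun (hρ : ρ.IsHermitian) (htr : ρ.trace = 1)
    (A B : Matrix (Fin n) (Fin n) ℂ) :
    symCov ρ A B =
      (centered ρ A * superFun (fun x y => (x + y) / 2) hρ (centered ρ B)).trace := by
  rw [symCov, cov_eq_trace_centered htr, cov_eq_trace_centered htr, superFun_arith,
    Matrix.mul_smul, Matrix.trace_smul, Matrix.mul_add, Matrix.trace_add, smul_eq_mul,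
    ← Matrix.mul_assoc (centered ρ A) (centered ρ B) ρ, Matrix.trace_mul_comm _ ρ,
    ← Matrix.mul_assoc ρ, Matrix.trace_mul_comm (centered ρ A), add_comm]

theorem symCov_re (hρ : ρ.IsHermitian) (htr : ρ.trace = 1)
    {A B : Matrix (Fin n) (Fin n) ℂ} (hA : A.IsHermitian) :
    (symCov ρ A B).re = wInner (eigenWeight (fun x y => (x + y) / 2) hρ)
      (eigenEntry hρ (centered ρ A)) (eigenEntry hρ (centered ρ B)) := by
  rw [symCov_eq_trace_superFun hρ htr, re_trace_mul_superFun _ hρ (centered_isHermitian hρ hA)]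

theorem var_eq_symCov_re (ρ A : Matrix (Fin n) (Fin n) ℂ) : var ρ A = (symCov ρ A A).re := by
  rw [var, symCov]
  congr 1
  ring

theorem star_cov (hρ : ρ.IsHermitian) {A B : Matrix (Fin n) (Fin n) ℂ} (hA : A.IsHermitian)
    (hB : B.IsHermitian) : star (cov ρ A B) = cov ρ B A := by
  rw [cov, star_sub, star_mul', trace_mul_conj hρ hA, trace_mul_conj hρ hB,
    ← Matrix.trace_conjTranspose, Matrix.conjTranspose_mul, Matrix.conjTranspose_mul, hρ.eq, hA.eq,
    hB.eq, ← Matrix.mul_assoc, Matrix.trace_mul_comm _ ρ, ← Matrix.mul_assoc, cov,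
    mul_comm (ρ * A).trace]

theorem symCov_im (hρ : ρ.IsHermitian) {A B : Matrix (Fin n) (Fin n) ℂ} (hA : A.IsHermitian)
    (hB : B.IsHermitian) : (symCov ρ A B).im = 0 := by
  rw [← Complex.conj_eq_iff_im, ← Complex.star_def, symCov, star_mul', star_add,
    star_cov hρ hA hB, star_cov hρ hB hA, add_comm]
  simp

theorem norm_symCov_sq (hρ : ρ.IsHermitian) {A B : Matrix (Fin n) (Fin n) ℂ}
    (hA : A.IsHermitian) (hB : B.IsHermitian) :
    ‖symCov ρ A B‖ ^ 2 = (symCov ρ A B).re ^ 2 := by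
  rw [Complex.sq_norm, Complex.normSq_apply, symCov_im hρ hA hB]
  ring

/-! ### Comparison of weights and the two inequalities -/

theorem eigenWeight_mono {s t : ℝ → ℝ → ℝ} (hρ : ρ.PosDef)
    (h : ∀ x y, 0 < x → 0 < y → s x y ≤ t x y) (p : Fin n × Fin n) :
    eigenWeight s hρ.isHermitian p ≤ eigenWeight t hρ.isHermitian p :=
  h _ _ (hρ.eigenvalues_pos p.1) (hρ.eigenvalues_pos p.2)

theorem Fop.eigenWeight_commWeight_nonneg {f : ℝ → ℝ} (hf : Fop f) (hρ : ρ.PosDef)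
    (p : Fin n × Fin n) : 0 ≤ eigenWeight (commWeight f) hρ.isHermitian p :=
  hf.commWeight_nonneg (hρ.eigenvalues_pos p.1) (hρ.eigenvalues_pos p.2)

theorem sq_area_iComm_le {A B : Matrix (Fin n) (Fin n) ℂ} (hρ : ρ.PosDef) (htr : ρ.trace = 1)
    (hA : A.IsHermitian) (hB : B.IsHermitian) {f : ℝ → ℝ} (hf : Fop f) :
    (valZero f / 2 * area (metric f hρ.isHermitian) (iComm ρ A) (iComm ρ B)) ^ 2 ≤
      var ρ A * var ρ B - ‖symCov ρ A B‖ ^ 2 := by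
  have hH := hρ.isHermitian
  have hw := hf.eigenWeight_commWeight_nonneg hρ
  -- Centering inside the commutators makes the area and the covariance refer to the same vectors;
  -- Cauchy-Schwarz then makes the radicand nonnegative, so squaring removes the root.
  rw [← iComm_centered ρ A, ← iComm_centered ρ B,
    valZero_mul_area_iComm hf hH (centered_isHermitian hH hA) (centered_isHermitian hH hB), area,
    sq_abs, Real.sq_sqrt (sub_nonneg.2 (wInner_sq_le hw _ _)), var_eq_symCov_re,
    var_eq_symCov_re, norm_symCov_sq hH hA hB, symCov_re hH htr hA, symCov_re hH htr hA,
    symCov_re hH htr hB]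
  exact gram_wInner_mono hw (eigenWeight_mono hρ fun _ _ => hf.commWeight_le) _ _

theorem area_iComm_le_of_tilde_le {A B : Matrix (Fin n) (Fin n) ℂ} (hρ : ρ.PosDef)
    (hA : A.IsHermitian) (hB : B.IsHermitian) {f g : ℝ → ℝ} (hf : Fop f) (hg : Fop g)
    (h : ∀ x, 0 < x → tilde f x ≤ tilde g x) :
    valZero g / 2 * area (metric g hρ.isHermitian) (iComm ρ A) (iComm ρ B) ≤
      valZero f / 2 * area (metric f hρ.isHermitian) (iComm ρ A) (iComm ρ B) := by
  rw [valZero_mul_area_iComm hf hρ.isHermitian hA hB,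
    valZero_mul_area_iComm hg hρ.isHermitian hA hB, area, area, sq_abs, sq_abs]
  exact Real.sqrt_le_sqrt (gram_wInner_mono (hg.eigenWeight_commWeight_nonneg hρ)
    (eigenWeight_mono hρ fun _ _ => commWeight_le_of_tilde_le h) _ _)

end MonotoneMetric

end

theorem mainTheorem1 {n : ℕ} (ρ A B : Matrix (Fin n) (Fin n) ℂ)
    (hρ : ρ.PosDef) (htr : ρ.trace = 1) (hA : A.IsHermitian) (hB : B.IsHermitian)
    (f g : ℝ → ℝ) (hf : MonotoneMetric.Fop f) (hg : MonotoneMetric.Fop g) :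
    ((MonotoneMetric.valZero f / 2 *
          MonotoneMetric.area (MonotoneMetric.metric f hρ.isHermitian)
            (MonotoneMetric.iComm ρ A) (MonotoneMetric.iComm ρ B)) ^ 2 ≤
        MonotoneMetric.var ρ A * MonotoneMetric.var ρ B - ‖MonotoneMetric.symCov ρ A B‖ ^ 2) ∧
      ((∀ x : ℝ, 0 < x → MonotoneMetric.tilde f x ≤ MonotoneMetric.tilde g x) →
        MonotoneMetric.valZero g / 2 *
            MonotoneMetric.area (MonotoneMetric.metric g hρ.isHermitian)
              (MonotoneMetric.iComm ρ A) (MonotoneMetric.iComm ρ B) ≤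
          MonotoneMetric.valZero f / 2 *
            MonotoneMetric.area (MonotoneMetric.metric f hρ.isHermitian)
              (MonotoneMetric.iComm ρ A) (MonotoneMetric.iComm ρ B)) :=
  ⟨MonotoneMetric.sq_area_iComm_le hρ htr hA hB hf,
    MonotoneMetric.area_iComm_le_of_tilde_le hρ hA hB hf hg⟩
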